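/- Let $d \ge 1$ be an integer. The \emph{pellytope} is the Newton polytope \[ \mathcal P_d := \mathrm{Newt}\Big(\prod_{i=1}^{d}(1+y_i)\,\prod_{j=1}^{d-1}(1+y_j+y_jy_{j+1})\Big) \subset \mathbb R^d , \] that is, the convex hull of the exponent vectors of all monomials occurring with nonzero coefficient in this polynomial in the variables $y_1,\dots,y_d$. The Pell numbers are defined by $n_1=1$, $n_2=2$ and $n_k = 2n_{k-1}+n_{k-2}$ for $k \ge 3$. Then $\mathcal P_d$ is a simple polytope of dimension $d$ (simple meaning that every vertex lies in exactly $d$ facets), and it has exactly $3d-1$ facets and exactly $n_{d+1}$ vertices. -/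

import Mathlib

noncomputable section

/-- The Newton polytope of a polynomial in `d` variables: the convex hull in `ℝ^d` of the
exponent vectors of the monomials that occur with a nonzero coefficient. -/
def newtonPolytope {d : ℕ} {R : Type*} [CommSemiring R] (f : MvPolynomial (Fin d) R) :
    Set (Fin d → ℝ) :=
  convexHull ℝ ((fun (m : Fin d →₀ ℕ) (i : Fin d) => (m i : ℝ)) '' (f.support : Set (Fin d →₀ ℕ)))

/-- The polynomial `∏_{i=1}^{d} (1 + y_i) * ∏_{j=1}^{d-1} (1 + y_j + y_j y_{j+1})`, with the
variables numbered from `0` to `d - 1`. -/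
def pellPolynomial (d : ℕ) : MvPolynomial (Fin d) ℤ :=
  (∏ i : Fin d, (1 + MvPolynomial.X i)) *
    ∏ j : Fin (d - 1),
      (1 + MvPolynomial.X (⟨j.val, by omega⟩ : Fin d)
        + MvPolynomial.X (⟨j.val, by omega⟩ : Fin d)
          * MvPolynomial.X (⟨j.val + 1, by omega⟩ : Fin d))

/-- The pellytope in `ℝ^d`. -/
def pellytope (d : ℕ) : Set (Fin d → ℝ) :=
  newtonPolytope (pellPolynomial d)

/-- Pell's numbers `n_1 = 1`, `n_2 = 2`, `n_k = 2 n_{k-1} + n_{k-2}`, extended by `n_0 = 0`. -/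
def pellNumber : ℕ → ℕ
  | 0 => 0
  | 1 => 1
  | k + 2 => 2 * pellNumber (k + 1) + pellNumber k

section Polytope

variable {E : Type*} [AddCommGroup E] [Module ℝ E] [TopologicalSpace E]

/-- A polytope is the convex hull of a nonempty finite set of points. -/
def IsPolytope (P : Set E) : Prop :=
  ∃ s : Finset E, s.Nonempty ∧ P = convexHull ℝ (s : Set E)

/-- The dimension of a nonempty convex set, that is, of its affine hull. -/
def convexDim (P : Set E) : ℕ :=
  Module.finrank ℝ (vectorSpan ℝ P)

/-- The facets of `P`: the nonempty faces (sets of maximizers over `P` of a linear functional) of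
dimension `dim P - 1`. -/
def polytopeFacets (P : Set E) : Set (Set E) :=
  {F | F.Nonempty ∧ IsExposed ℝ P F ∧ convexDim F + 1 = convexDim P}

/-- The vertices of `P`: the points `v` such that `{v}` is a face of `P`. -/
def polytopeVertices (P : Set E) : Set E :=
  {v | IsExposed ℝ P {v}}

/-- A polytope is simple if every vertex lies on exactly `dim P` facets. -/
def IsSimplePolytope (P : Set E) : Prop :=
  IsPolytope P ∧
    ∀ v ∈ polytopeVertices P,
      {F | F ∈ polytopeFacets P ∧ v ∈ F}.Finite ∧
        {F | F ∈ polytopeFacets P ∧ v ∈ F}.ncard = convexDim P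

end Polytope

end

/-!
The pellytope is the polyhedron of the `3d - 1` inequalities `0 ≤ x_i`, `x_i ≤ β_i` and
`x_{j+1} - x_j ≤ γ_j`, where `β_i` and `γ_j` are the maxima over the exponent vectors. The outer
normals `e_i`, `-e_i` and `e_{j+1} - e_j` are the rays of a complete simplicial fan whose maximal
cones choose one normal for each coordinate; the choices that occur are words with a local
transition rule, so a recursion on the first letter counts them by Pell numbers. A functional
`c` lies in the cone of the word read off from the signs of the `c_i` and of the
`c_j + c_{j+1}`, and the point where the inequalities of a cone are tight is an exponent vector at
which all the others are strict. Such a fan is the normal fan of the polyhedron: its rays are the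
facets, its maximal cones are the vertices, and every vertex lies on the `d` facets given by the
rays of its cone.
-/

/-- The outer normals `normal a` and right-hand sides `bound a` of the facet inequalities of a
polyhedron, together with a complete simplicial fan, its normal fan. The maximal cone with index
`k` is spanned by the functionals `normal (cone k j)`; they are the coordinate functionals of the
basis `edge k`, so that the edges leaving the vertex `vertex k` have the directions
`-edge k j`. -/
structure SimplicialNormalFan (E ι κ J : Type*) [AddCommGroup E] [Module ℝ E]
    [TopologicalSpace E] where
  normal : ι → StrongDual ℝ E
  bound : ι → ℝ
  cone : κ → J → ι
  edge : κ → Module.Basis J ℝ E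
  vertex : κ → E
  normal_cone : ∀ k j x, normal (cone k j) x = (edge k).repr x j
  complete : ∀ u : StrongDual ℝ E, ∃ k, ∀ j, 0 ≤ u (edge k j)
  exists_cone : ∀ a, ∃ k j, cone k j = a
  normal_cone_vertex : ∀ k j, normal (cone k j) (vertex k) = bound (cone k j)
  normal_vertex_lt : ∀ k a, a ∉ Set.range (cone k) → normal a (vertex k) < bound a
  vertex_injective : Function.Injective vertex

namespace SimplicialNormalFan

variable {E ι κ J : Type*} [AddCommGroup E] [Module ℝ E] [TopologicalSpace E]
  (D : SimplicialNormalFan E ι κ J)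

/-- The polyhedron cut out by the facet inequalities. -/
def polyhedron : Set E := {x | ∀ a, D.normal a x ≤ D.bound a}

/-- The face of the polyhedron on which the inequality with index `a` is tight. -/
def facet (a : ι) : Set E := {x ∈ D.polyhedron | D.normal a x = D.bound a}

theorem normal_cone_edge_self (k : κ) (j : J) : D.normal (D.cone k j) (D.edge k j) = 1 := by
  simp [D.normal_cone]

theorem normal_cone_edge_of_ne (k : κ) {i j : J} (hij : i ≠ j) :
    D.normal (D.cone k i) (D.edge k j) = 0 := by
  simp [D.normal_cone, hij.symm]

theorem cone_injective (k : κ) : Function.Injective (D.cone k) := by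
  intro i j hij
  by_contra hne
  have h := D.normal_cone_edge_of_ne k hne
  rw [hij, D.normal_cone_edge_self] at h
  exact one_ne_zero h

theorem convex_polyhedron : Convex ℝ D.polyhedron := by
  rw [polyhedron, Set.ofPred_forall]
  exact convex_iInter fun a => convex_halfSpace_le (D.normal a).isLinear (D.bound a)

theorem vertex_mem_polyhedron (k : κ) : D.vertex k ∈ D.polyhedron := by
  intro a
  by_cases ha : a ∈ Set.range (D.cone k)
  · obtain ⟨j, rfl⟩ := ha
    exact (D.normal_cone_vertex k j).le
  · exact (D.normal_vertex_lt k a ha).le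

theorem vertex_mem_facet_iff {k : κ} {a : ι} :
    D.vertex k ∈ D.facet a ↔ a ∈ Set.range (D.cone k) := by
  constructor
  · intro h
    by_contra ha
    exact (D.normal_vertex_lt k a ha).ne h.2
  · rintro ⟨j, rfl⟩
    exact ⟨D.vertex_mem_polyhedron k, D.normal_cone_vertex k j⟩

theorem facet_nonempty (a : ι) : (D.facet a).Nonempty := by
  obtain ⟨k, j, hj⟩ := D.exists_cone a
  exact ⟨D.vertex k, D.vertex_mem_facet_iff.2 ⟨j, hj⟩⟩

theorem isExposed_facet (a : ι) : IsExposed ℝ D.polyhedron (D.facet a) := by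
  rintro ⟨x, hx⟩
  refine ⟨D.normal a, Set.ext fun y => and_congr_right fun hy => ⟨fun h z hz => ?_, fun h => ?_⟩⟩
  · exact h ▸ hz a
  · exact (hy a).antisymm (hx.2 ▸ h x hx.1)

section Maximizers

variable {k : κ} {u : StrongDual ℝ E} {x : E}

theorem apply_eq_sum_normal_mul_edge [Fintype J] (k : κ) (u : StrongDual ℝ E) (x : E) :
    u x = ∑ j, D.normal (D.cone k j) x * u (D.edge k j) := by
  conv_lhs => rw [← (D.edge k).sum_repr x]
  simp only [map_sum, map_smul, smul_eq_mul, D.normal_cone]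

variable [Finite J]

theorem apply_le_apply_vertex (hu : ∀ j, 0 ≤ u (D.edge k j)) (hx : x ∈ D.polyhedron) :
    u x ≤ u (D.vertex k) := by
  have := Fintype.ofFinite J
  rw [D.apply_eq_sum_normal_mul_edge k u x, D.apply_eq_sum_normal_mul_edge k u (D.vertex k)]
  refine Finset.sum_le_sum fun j _ => mul_le_mul_of_nonneg_right ?_ (hu j)
  exact (hx _).trans_eq (D.normal_cone_vertex k j).symm

theorem apply_eq_apply_vertex_iff (hu : ∀ j, 0 ≤ u (D.edge k j)) (hx : x ∈ D.polyhedron) :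
    u x = u (D.vertex k) ↔ ∀ j, 0 < u (D.edge k j) → x ∈ D.facet (D.cone k j) := by
  have := Fintype.ofFinite J
  have hle (j) (_ : j ∈ Finset.univ) : D.normal (D.cone k j) x * u (D.edge k j) ≤
      D.normal (D.cone k j) (D.vertex k) * u (D.edge k j) :=
    mul_le_mul_of_nonneg_right ((hx _).trans_eq (D.normal_cone_vertex k j).symm) (hu j)
  rw [D.apply_eq_sum_normal_mul_edge k u x, D.apply_eq_sum_normal_mul_edge k u (D.vertex k),
    Finset.sum_eq_sum_iff_of_le hle]
  refine forall_congr' fun j => ?_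
  rcases (hu j).eq_or_lt with hj | hj
  · simp [← hj]
  · simp [hj, hj.ne', facet, hx, D.normal_cone_vertex]

theorem maximizers_eq (hu : ∀ j, 0 ≤ u (D.edge k j)) :
    {x ∈ D.polyhedron | ∀ y ∈ D.polyhedron, u y ≤ u x} =
      {x ∈ D.polyhedron | ∀ j, 0 < u (D.edge k j) → x ∈ D.facet (D.cone k j)} := by
  refine Set.ext fun x => and_congr_right fun hx => ?_
  rw [← D.apply_eq_apply_vertex_iff hu hx]
  exact ⟨fun h => (D.apply_le_apply_vertex hu hx).antisymm (h _ (D.vertex_mem_polyhedron k)),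
    fun h y hy => h ▸ D.apply_le_apply_vertex hu hy⟩

theorem isExposed_singleton_vertex (k : κ) : IsExposed ℝ D.polyhedron {D.vertex k} := by
  intro _
  have := Fintype.ofFinite J
  let u : StrongDual ℝ E := ∑ j, D.normal (D.cone k j)
  have hu (j) : u (D.edge k j) = 1 := by
    classical simp [u, D.normal_cone, Finsupp.single_apply]
  refine ⟨u, Eq.symm ?_⟩
  rw [D.maximizers_eq fun j => (hu j).symm ▸ zero_le_one]
  refine Set.eq_singleton_iff_unique_mem.2
    ⟨⟨D.vertex_mem_polyhedron k, fun j _ => D.vertex_mem_facet_iff.2 ⟨j, rfl⟩⟩, fun x hx => ?_⟩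
  refine (D.edge k).repr.injective (Finsupp.ext fun j => ?_)
  rw [← D.normal_cone, ← D.normal_cone, D.normal_cone_vertex]
  exact (hx.2 j (by simp [hu])).2

theorem polytopeVertices_polyhedron : polytopeVertices D.polyhedron = Set.range D.vertex := by
  ext v
  constructor
  · intro hv
    obtain ⟨u, hu⟩ := hv (Set.singleton_nonempty v)
    obtain ⟨k, hk⟩ := D.complete u
    have hkv : D.vertex k ∈ ({v} : Set E) :=
      hu ▸ ⟨D.vertex_mem_polyhedron k, fun y hy => D.apply_le_apply_vertex hk hy⟩
    exact ⟨k, hkv⟩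
  · rintro ⟨k, rfl⟩
    exact D.isExposed_singleton_vertex k

theorem ncard_polytopeVertices : (polytopeVertices D.polyhedron).ncard = Nat.card κ := by
  rw [D.polytopeVertices_polyhedron, Set.ncard_range_of_injective D.vertex_injective]

end Maximizers

section ConvexHull

variable [Finite J] [Finite κ] [IsTopologicalAddGroup E] [ContinuousSMul ℝ E]
  [LocallyConvexSpace ℝ E] [T2Space E]

theorem polyhedron_subset_convexHull : D.polyhedron ⊆ convexHull ℝ (Set.range D.vertex) := by
  intro x hx
  by_contra hxs
  obtain ⟨u, c, hlt, hgt⟩ := geometric_hahn_banach_closed_point (convex_convexHull ℝ _)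
    ((Set.finite_range D.vertex).isClosed_convexHull ℝ) hxs
  obtain ⟨k, hk⟩ := D.complete u
  have hvertex := hlt _ (subset_convexHull ℝ _ ⟨k, rfl⟩)
  exact (D.apply_le_apply_vertex hk hx).not_gt (hvertex.trans hgt)

theorem convexHull_eq_polyhedron {s : Set E} (hvertex : ∀ k, D.vertex k ∈ s)
    (hs : s ⊆ D.polyhedron) : convexHull ℝ s = D.polyhedron :=
  (convexHull_min hs D.convex_polyhedron).antisymm <|
    D.polyhedron_subset_convexHull.trans (convexHull_mono (Set.range_subset_iff.2 hvertex))

theorem isPolytope_polyhedron : IsPolytope D.polyhedron := by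
  have : Nonempty κ := (D.complete 0).nonempty
  refine ⟨(Set.finite_range D.vertex).toFinset, by simp [Set.range_nonempty], ?_⟩
  rw [Set.Finite.coe_toFinset]
  exact (D.convexHull_eq_polyhedron Set.mem_range_self
    (Set.range_subset_iff.2 D.vertex_mem_polyhedron)).symm

end ConvexHull

section Dimension

variable {F : Set E} {a : ι}

theorem vectorSpan_le_ker_normal (hF : F ⊆ D.facet a) :
    vectorSpan ℝ F ≤ LinearMap.ker (D.normal a : E →ₗ[ℝ] ℝ) := by
  refine Submodule.span_le.2 ?_
  rintro _ ⟨y, hy, z, hz, rfl⟩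
  simp [(hF hy).2, (hF hz).2]

variable [Finite ι]

theorem exists_vertex_sub_smul_edge_mem (k : κ) (j : J) :
    ∃ ε : ℝ, 0 < ε ∧ D.vertex k - ε • D.edge k j ∈ D.polyhedron := by
  have hmem (a) : ∀ᶠ ε in nhdsWithin (0 : ℝ) (Set.Ioi 0),
      D.normal a (D.vertex k - ε • D.edge k j) ≤ D.bound a := by
    simp only [map_sub, map_smul, smul_eq_mul]
    by_cases ha : a ∈ Set.range (D.cone k)
    · obtain ⟨i, rfl⟩ := ha
      filter_upwards [self_mem_nhdsWithin] with ε hε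
      have hnonneg : 0 ≤ D.normal (D.cone k i) (D.edge k j) := by
        rw [D.normal_cone, Module.Basis.repr_self]
        exact Finsupp.single_nonneg.2 zero_le_one i
      rw [D.normal_cone_vertex]
      exact sub_le_self _ (mul_nonneg (Set.mem_Ioi.1 hε).le hnonneg)
    · have hcont : Continuous fun ε : ℝ =>
          D.normal a (D.vertex k) - ε * D.normal a (D.edge k j) := by fun_prop
      have hlim := hcont.continuousWithinAt.tendsto (s := Set.Ioi 0) (x := 0)
      rw [zero_mul, sub_zero] at hlim
      exact hlim.eventually_le_const (D.normal_vertex_lt k a ha)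
  obtain ⟨ε, hε, hpos⟩ := ((Filter.eventually_all.2 hmem).and self_mem_nhdsWithin).exists
  exact ⟨ε, hpos, hε⟩

theorem edge_mem_vectorSpan (k : κ) (j : J) : D.edge k j ∈ vectorSpan ℝ D.polyhedron := by
  obtain ⟨ε, hε, hmem⟩ := D.exists_vertex_sub_smul_edge_mem k j
  have hspan := vsub_mem_vectorSpan ℝ (D.vertex_mem_polyhedron k) hmem
  rw [vsub_eq_sub, sub_sub_cancel] at hspan
  exact (Submodule.smul_mem_iff _ hε.ne').1 hspan

theorem edge_mem_vectorSpan_facet (k : κ) {i j : J} (hij : i ≠ j) :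
    D.edge k j ∈ vectorSpan ℝ (D.facet (D.cone k i)) := by
  obtain ⟨ε, hε, hmem⟩ := D.exists_vertex_sub_smul_edge_mem k j
  have hfacet : D.vertex k - ε • D.edge k j ∈ D.facet (D.cone k i) := by
    refine ⟨hmem, ?_⟩
    simp [D.normal_cone_vertex, D.normal_cone_edge_of_ne k hij]
  have hspan := vsub_mem_vectorSpan ℝ (D.vertex_mem_facet_iff.2 ⟨i, rfl⟩) hfacet
  rw [vsub_eq_sub, sub_sub_cancel] at hspan
  exact (Submodule.smul_mem_iff _ hε.ne').1 hspan

theorem vectorSpan_polyhedron : vectorSpan ℝ D.polyhedron = ⊤ := by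
  obtain ⟨k, -⟩ := D.complete 0
  rw [eq_top_iff, ← (D.edge k).span_eq, Submodule.span_le, Set.range_subset_iff]
  exact D.edge_mem_vectorSpan k

theorem convexDim_polyhedron : convexDim D.polyhedron = Module.finrank ℝ E := by
  rw [convexDim, D.vectorSpan_polyhedron, finrank_top]

include D in
theorem finite_edgeIndex : Finite J := by
  obtain ⟨k, -⟩ := D.complete 0
  exact Finite.of_injective _ (D.cone_injective k)

theorem vectorSpan_facet (a : ι) :
    vectorSpan ℝ (D.facet a) = LinearMap.ker (D.normal a : E →ₗ[ℝ] ℝ) := by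
  obtain ⟨k, i, rfl⟩ := D.exists_cone a
  refine (D.vectorSpan_le_ker_normal subset_rfl).antisymm fun x hx => ?_
  rw [← (D.edge k).linearCombination_repr x]
  refine Submodule.sum_mem _ fun j _ => ?_
  rcases eq_or_ne i j with rfl | hij
  · have hx : (D.edge k).repr x i = 0 := D.normal_cone k i x ▸ hx
    simp [hx]
  · exact Submodule.smul_mem _ _ (D.edge_mem_vectorSpan_facet k hij)

theorem convexDim_facet_add_one (a : ι) :
    convexDim (D.facet a) + 1 = convexDim D.polyhedron := by
  obtain ⟨k, i, rfl⟩ := D.exists_cone a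
  have := D.finite_edgeIndex
  have := (D.edge k).finiteDimensional_of_finite
  have hne : (D.normal (D.cone k i) : E →ₗ[ℝ] ℝ) ≠ 0 := fun h =>
    one_ne_zero ((D.normal_cone_edge_self k i).symm.trans (LinearMap.congr_fun h (D.edge k i)))
  rw [convexDim, D.vectorSpan_facet, D.convexDim_polyhedron]
  exact Module.Dual.finrank_ker_add_one_of_ne_zero hne

theorem convexDim_lt_convexDim_facet {k : κ} {i j : J} (hij : i ≠ j)
    (hi : F ⊆ D.facet (D.cone k i)) (hj : F ⊆ D.facet (D.cone k j)) :
    convexDim F < convexDim (D.facet (D.cone k i)) := by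
  have := D.finite_edgeIndex
  have := (D.edge k).finiteDimensional_of_finite
  refine Submodule.finrank_lt_finrank_of_lt ((vectorSpan_mono ℝ hi).lt_of_not_ge fun hle => ?_)
  have hzero : D.normal (D.cone k j) (D.edge k j) = 0 :=
    D.vectorSpan_le_ker_normal hj (hle (D.edge_mem_vectorSpan_facet k hij))
  exact one_ne_zero ((D.normal_cone_edge_self k j).symm.trans hzero)

theorem facet_injective : Function.Injective D.facet := by
  intro a b hab
  obtain ⟨k, i, rfl⟩ := D.exists_cone a
  obtain ⟨j, rfl⟩ := D.vertex_mem_facet_iff.1 (hab ▸ D.vertex_mem_facet_iff.2 ⟨i, rfl⟩)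
  by_contra hne
  have hij : i ≠ j := fun h => hne (congrArg _ h)
  exact (D.convexDim_lt_convexDim_facet hij subset_rfl hab.subset).false

theorem exists_eq_facet_of_mem_polytopeFacets (hF : F ∈ polytopeFacets D.polyhedron) :
    ∃ a, D.facet a = F := by
  have := D.finite_edgeIndex
  obtain ⟨hne, hexp, hdim⟩ := hF
  obtain ⟨u, hu⟩ := hexp hne
  obtain ⟨k, hk⟩ := D.complete u
  rw [D.maximizers_eq hk] at hu
  have hsub {j} (hj : 0 < u (D.edge k j)) : F ⊆ D.facet (D.cone k j) :=
    hu ▸ fun x hx => hx.2 j hj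
  obtain ⟨i, hi⟩ : ∃ i, 0 < u (D.edge k i) := by
    by_contra! hnonpos
    have hFP : F = D.polyhedron :=
      hu.trans (Set.sep_eq_self_iff_mem_true.2 fun x _ j hj => absurd hj (hnonpos j).not_gt)
    rw [hFP] at hdim
    omega
  have hunique {j} (hj : 0 < u (D.edge k j)) : i = j := by
    by_contra hij
    have hlt := D.convexDim_lt_convexDim_facet hij (hsub hi) (hsub hj)
    have hfacet := D.convexDim_facet_add_one (D.cone k i)
    omega
  refine ⟨D.cone k i, Set.Subset.antisymm (fun x hx => ?_) (hsub hi)⟩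
  rw [hu]
  exact ⟨hx.1, fun j hj => hunique hj ▸ hx⟩

theorem polytopeFacets_polyhedron : polytopeFacets D.polyhedron = Set.range D.facet := by
  ext F
  refine ⟨D.exists_eq_facet_of_mem_polytopeFacets, ?_⟩
  rintro ⟨a, rfl⟩
  exact ⟨D.facet_nonempty a, D.isExposed_facet a, D.convexDim_facet_add_one a⟩

theorem ncard_polytopeFacets : (polytopeFacets D.polyhedron).ncard = Nat.card ι := by
  rw [D.polytopeFacets_polyhedron, Set.ncard_range_of_injective D.facet_injective]

theorem facets_through_vertex (k : κ) :
    {F | F ∈ polytopeFacets D.polyhedron ∧ D.vertex k ∈ F} = Set.range (D.facet ∘ D.cone k) := by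
  rw [D.polytopeFacets_polyhedron, Set.range_comp]
  ext F
  constructor
  · rintro ⟨⟨a, rfl⟩, hv⟩
    exact ⟨a, D.vertex_mem_facet_iff.1 hv, rfl⟩
  · rintro ⟨a, ha, rfl⟩
    exact ⟨⟨a, rfl⟩, D.vertex_mem_facet_iff.2 ha⟩

theorem isSimplePolytope_polyhedron [Finite κ] [IsTopologicalAddGroup E] [ContinuousSMul ℝ E]
    [LocallyConvexSpace ℝ E] [T2Space E] : IsSimplePolytope D.polyhedron := by
  have := D.finite_edgeIndex
  refine ⟨D.isPolytope_polyhedron, fun v hv => ?_⟩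
  rw [D.polytopeVertices_polyhedron] at hv
  obtain ⟨k, rfl⟩ := hv
  rw [D.facets_through_vertex]
  refine ⟨Set.finite_range _, ?_⟩
  rw [Set.ncard_range_of_injective (D.facet_injective.comp (D.cone_injective k)),
    D.convexDim_polyhedron, Module.finrank_eq_nat_card_basis (D.edge k)]

end Dimension

end SimplicialNormalFan

section Support

open MvPolynomial
open scoped Pointwise

variable {σ R : Type*} [CommSemiring R] [PartialOrder R] [CanonicallyOrderedAdd R]

theorem support_add_of_canonicallyOrdered [DecidableEq σ] (f g : MvPolynomial σ R) :
    (f + g).support = f.support ∪ g.support := by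
  ext m
  simp only [mem_support_iff, coeff_add, Finset.mem_union, ne_eq, add_eq_zero, not_and_or]

theorem mem_support_one_add_X [Nontrivial R] (i : σ) (m : σ →₀ ℕ) :
    m ∈ (1 + X i : MvPolynomial σ R).support ↔ ∃ p ≤ 1, m = Finsupp.single i p := by
  classical
  rw [support_add_of_canonicallyOrdered, support_one, support_X, Finset.mem_union,
    Finset.mem_singleton, Finset.mem_singleton]
  constructor
  · rintro (rfl | rfl)
    · exact ⟨0, zero_le_one, by simp⟩
    · exact ⟨1, le_rfl, rfl⟩
  · rintro ⟨p, hp, rfl⟩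
    interval_cases p <;> simp

theorem mem_support_one_add_X_add_X_mul_X [Nontrivial R] (i j : σ) (m : σ →₀ ℕ) :
    m ∈ (1 + X i + X i * X j : MvPolynomial σ R).support ↔
      ∃ q r, r ≤ q ∧ q ≤ 1 ∧ m = Finsupp.single i q + Finsupp.single j r := by
  classical
  rw [support_add_of_canonicallyOrdered, Finset.mem_union, mem_support_one_add_X, X, X,
    monomial_mul, mul_one, support_monomial, if_neg one_ne_zero, Finset.mem_singleton]
  constructor
  · rintro (⟨q, hq, rfl⟩ | rfl)
    · exact ⟨q, 0, q.zero_le, hq, by simp⟩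
    · exact ⟨1, 1, le_rfl, le_rfl, rfl⟩
  · rintro ⟨q, r, hr, hq, rfl⟩
    interval_cases q <;> interval_cases r
    · exact Or.inl ⟨0, by simp⟩
    · exact Or.inl ⟨1, by simp⟩
    · exact Or.inr rfl

variable [NoZeroDivisors R]

theorem coe_support_mul_of_canonicallyOrdered (f g : MvPolynomial σ R) :
    ((f * g).support : Set (σ →₀ ℕ)) = f.support + g.support := by
  classical
  ext m
  simp only [Finset.mem_coe, mem_support_iff, coeff_mul, ne_eq, Finset.sum_eq_zero_iff,
    mul_eq_zero, Set.mem_add, Prod.forall, Finset.HasAntidiagonal.mem_antidiagonal]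
  push Not
  exact ⟨fun ⟨a, b, h, ha, hb⟩ => ⟨a, ha, b, hb, h⟩, fun ⟨a, ha, b, hb, h⟩ => ⟨a, b, h, ha, hb⟩⟩

theorem coe_support_prod_of_canonicallyOrdered [Nontrivial R] {τ : Type*} (t : Finset τ)
    (f : τ → MvPolynomial σ R) :
    ((∏ i ∈ t, f i).support : Set (σ →₀ ℕ)) = ∑ i ∈ t, ((f i).support : Set (σ →₀ ℕ)) := by
  classical
  induction t using Finset.induction_on with
  | empty => simp [support_one, Set.singleton_zero]
  | insert a t ha ih =>
    rw [Finset.prod_insert ha, Finset.sum_insert ha, coe_support_mul_of_canonicallyOrdered, ih]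

end Support

section PellPolynomial

variable {n : ℕ}

/-- The exponent vector of the monomial of the Pell polynomial obtained by choosing `y_i ^ p i`
from the factor `1 + y_i` and `y_j ^ q j * y_{j+1} ^ r j` from the factor
`1 + y_j + y_j y_{j+1}`. -/
def chosenExponent (p : Fin (n + 1) → ℕ) (q r : Fin n → ℕ) (i : Fin (n + 1)) : ℕ :=
  p i + Fin.snoc (α := fun _ => ℕ) q 0 i + Fin.cons (α := fun _ => ℕ) 0 r i

theorem chosenExponent_eq_sum_single (p : Fin (n + 1) → ℕ) (q r : Fin n → ℕ) :
    Finsupp.equivFunOnFinite.symm (chosenExponent p q r) = ∑ i, Finsupp.single i (p i) +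
      ∑ j, (Finsupp.single j.castSucc (q j) + Finsupp.single j.succ (r j)) := by
  have hsnoc (i : Fin (n + 1)) : ∑ j, Finsupp.single (M := ℕ) j.castSucc (q j) i =
      Fin.snoc (α := fun _ => ℕ) q 0 i := by
    induction i using Fin.lastCases <;> simp [Finsupp.single_apply]
  have hcons (i : Fin (n + 1)) : ∑ j, Finsupp.single (M := ℕ) j.succ (r j) i =
      Fin.cons (α := fun _ => ℕ) 0 r i := by
    induction i using Fin.cases <;> simp [Finsupp.single_apply]
  rw [← Finsupp.equivFunOnFinite_symm_eq_sum]
  ext i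
  simp only [Finset.sum_add_distrib, Finsupp.add_apply, Finsupp.finsetSum_apply, hsnoc, hcons,
    Finsupp.equivFunOnFinite_symm_apply_apply, chosenExponent, add_assoc]

theorem pellPolynomial_eq_map (n : ℕ) :
    pellPolynomial (n + 1) = MvPolynomial.map (Nat.castRingHom ℤ)
      ((∏ i : Fin (n + 1), (1 + MvPolynomial.X i)) *
        ∏ j : Fin n, (1 + MvPolynomial.X j.castSucc
          + MvPolynomial.X j.castSucc * MvPolynomial.X j.succ)) := by
  simp only [map_mul, map_prod, map_add, map_one, MvPolynomial.map_X]
  rfl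

theorem mem_support_pellPolynomial (m : Fin (n + 1) →₀ ℕ) :
    m ∈ (pellPolynomial (n + 1)).support ↔
      ∃ (p : Fin (n + 1) → ℕ) (q r : Fin n → ℕ), (∀ i, p i ≤ 1) ∧ (∀ j, r j ≤ q j) ∧
        (∀ j, q j ≤ 1) ∧ m = Finsupp.equivFunOnFinite.symm (chosenExponent p q r) := by
  rw [pellPolynomial_eq_map, MvPolynomial.support_map_of_injective _ Nat.cast_injective,
    ← Finset.mem_coe, coe_support_mul_of_canonicallyOrdered,
    coe_support_prod_of_canonicallyOrdered, coe_support_prod_of_canonicallyOrdered, Set.mem_add]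
  simp only [Set.mem_fintype_sum, Finset.mem_coe, mem_support_one_add_X,
    mem_support_one_add_X_add_X_mul_X, chosenExponent_eq_sum_single]
  constructor
  · rintro ⟨_, ⟨f, hf, rfl⟩, _, ⟨g, hg, rfl⟩, rfl⟩
    choose p hp hfp using hf
    choose q r hr hq hg using hg
    exact ⟨p, q, r, hp, hr, hq, by simp only [hfp, hg]⟩
  · rintro ⟨p, q, r, hp, hr, hq, rfl⟩
    exact ⟨_, ⟨_, fun i => ⟨p i, hp i, rfl⟩, rfl⟩,
      _, ⟨_, fun j => ⟨q j, r j, hr j, hq j, rfl⟩, rfl⟩, rfl⟩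

end PellPolynomial

/-- The four ways in which a coordinate of a vertex of the pellytope can be determined: by the
inequality `x_i ≥ 0` (`lower`), by the upper bound on `x_i` (`upper`), by the bound on
`x_i - x_{i-1}` (`stepIn`) or by the bound on `x_{i+1} - x_i` (`stepOut`). -/
inductive PellLetter
  | lower
  | upper
  | stepIn
  | stepOut
  deriving DecidableEq

namespace PellLetter

instance : Fintype PellLetter :=
  ⟨{lower, upper, stepIn, stepOut}, fun a => by cases a <;> decide⟩

/-- The transitions that are allowed between the letters of neighbouring coordinates. -/
def Follows (a b : PellLetter) : Prop :=
  (b = stepIn → a = lower) ∧ (a = stepOut → b = upper) ∧ ¬(a = lower ∧ b = upper)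

instance : DecidableRel Follows := fun a b => by unfold Follows; infer_instance

/-- The words with allowed transitions and no `stepOut` at the last coordinate; they need not be
admissible at coordinate `0`. -/
def IsAdmissible {n : ℕ} (w : Fin (n + 1) → PellLetter) : Prop :=
  w (Fin.last n) ≠ stepOut ∧ ∀ j : Fin n, Follows (w j.castSucc) (w j.succ)

theorem isAdmissible_cons {n : ℕ} (l : PellLetter) (w : Fin (n + 1) → PellLetter) :
    IsAdmissible (Fin.cons (α := fun _ => PellLetter) l w) ↔ Follows l (w 0) ∧ IsAdmissible w := by
  rw [IsAdmissible, IsAdmissible, Fin.forall_fin_succ, ← Fin.succ_last, Fin.cons_succ]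
  simp only [Fin.castSucc_zero, Fin.cons_zero, Fin.cons_succ, ← Fin.succ_castSucc]
  exact and_left_comm

/-- The number of words of length `n` that continue the letter `l` to an admissible word. -/
noncomputable def continuationCount (n : ℕ) (l : PellLetter) : ℕ :=
  Nat.card {w : Fin n → PellLetter // IsAdmissible (Fin.cons (α := fun _ => PellLetter) l w)}

theorem continuationCount_zero (l : PellLetter) :
    continuationCount 0 l = if l = stepOut then 0 else 1 := by
  split_ifs with h <;> simp [continuationCount, IsAdmissible, h]

theorem continuationCount_succ (n : ℕ) (l : PellLetter) :
    continuationCount (n + 1) l = ∑ a, if Follows l a then continuationCount n a else 0 := by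
  let e : {w : Fin (n + 1) → PellLetter // IsAdmissible (Fin.cons (α := fun _ => PellLetter) l w)} ≃
      Σ a, {w : Fin n → PellLetter //
        Follows l a ∧ IsAdmissible (Fin.cons (α := fun _ => PellLetter) a w)} :=
    ((Fin.consEquiv fun _ => PellLetter).symm.subtypeEquiv fun w => by
      rw [isAdmissible_cons, ← Fin.cons_self_tail w]; rfl).trans
      (Equiv.subtypeProdEquivSigmaSubtype _)
  rw [continuationCount, Nat.card_congr e, Nat.card_sigma]
  refine Finset.sum_congr rfl fun a _ => ?_
  split_ifs with h <;> simp [continuationCount, h]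

theorem continuationCount_eq_pellNumber (n : ℕ) :
    (∀ l, l ≠ stepOut → continuationCount n l = pellNumber (n + 1)) ∧
      continuationCount n stepOut = pellNumber n := by
  induction n with
  | zero => simp +contextual [continuationCount_zero, pellNumber]
  | succ n ih =>
    have hsum (f : PellLetter → ℕ) : ∑ a, f a = f lower + (f upper + (f stepIn + f stepOut)) := rfl
    simp only [continuationCount_succ, hsum, ih.1 lower (by decide), ih.1 upper (by decide),
      ih.1 stepIn (by decide), ih.2]
    refine ⟨fun l hl => ?_, by simp [Follows]⟩
    cases l <;> simp [Follows, pellNumber] at hl ⊢ <;> omega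

end PellLetter

open PellLetter

/-- The words that encode the vertices of the pellytope. Equivalently, a word is a tiling of the
path of coordinates by the singletons `lower` and `upper` and the dominoes `lower stepIn` and
`stepOut upper` in which the singleton `lower` is never followed by the singleton `upper`. -/
structure IsPellWord {n : ℕ} (w : Fin (n + 1) → PellLetter) : Prop where
  zero : w 0 ≠ stepIn
  last : w (Fin.last n) ≠ stepOut
  follows : ∀ j : Fin n, Follows (w j.castSucc) (w j.succ)

theorem isPellWord_iff_isAdmissible_cons {n : ℕ} (w : Fin (n + 1) → PellLetter) :
    IsPellWord w ↔ IsAdmissible (Fin.cons (α := fun _ => PellLetter) upper w) := by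
  have hupper : ∀ a, Follows upper a ↔ a ≠ stepIn := by decide
  rw [isAdmissible_cons, hupper]
  exact ⟨fun h => ⟨h.zero, h.last, h.follows⟩, fun h => ⟨h.1, h.2.1, h.2.2⟩⟩

theorem card_isPellWord (n : ℕ) :
    Nat.card {w : Fin (n + 1) → PellLetter // IsPellWord w} = pellNumber (n + 2) := by
  simp only [isPellWord_iff_isAdmissible_cons]
  exact (continuationCount_eq_pellNumber (n + 1)).1 upper (by decide)

namespace IsPellWord

variable {n : ℕ} {w : Fin (n + 1) → PellLetter} (hw : IsPellWord w)
include hw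

theorem exists_succ {i : Fin (n + 1)} (hi : w i = stepIn) :
    ∃ j : Fin n, i = j.succ ∧ w j.castSucc = lower := by
  induction i using Fin.cases with
  | zero => exact absurd hi hw.zero
  | succ j => exact ⟨j, rfl, (hw.follows j).1 hi⟩

theorem exists_castSucc {i : Fin (n + 1)} (hi : w i = stepOut) :
    ∃ j : Fin n, i = j.castSucc ∧ w j.succ = upper := by
  induction i using Fin.lastCases with
  | last => exact absurd hi hw.last
  | cast j => exact ⟨j, rfl, (hw.follows j).2.1 hi⟩

end IsPellWord

section Inequalities

variable {n : ℕ}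

/-- The indices of the facet inequalities of the pellytope: an upper bound on `x_i`, the lower
bound `0 ≤ x_i`, and an upper bound on the step `x_{j+1} - x_j`. -/
inductive PellInequality (n : ℕ)
  | upper (i : Fin (n + 1))
  | lower (i : Fin (n + 1))
  | step (j : Fin n)

/-- The indicator of the coordinates that have a successor. -/
def hasNext (i : Fin (n + 1)) : ℕ := Fin.snoc (α := fun _ => ℕ) 1 0 i

/-- The indicator of the coordinates that have a predecessor. -/
def hasPrev (i : Fin (n + 1)) : ℕ := Fin.cons (α := fun _ => ℕ) 0 1 i

@[simp] theorem hasNext_castSucc (j : Fin n) : hasNext j.castSucc = 1 := by simp [hasNext]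
@[simp] theorem hasNext_last : hasNext (Fin.last n) = 0 := by simp [hasNext]
@[simp] theorem hasPrev_succ (j : Fin n) : hasPrev j.succ = 1 := by simp [hasPrev]
@[simp] theorem hasPrev_zero : hasPrev (0 : Fin (n + 1)) = 0 := by simp [hasPrev]

namespace PellInequality

def equivSum : PellInequality n ≃ Fin (n + 1) ⊕ Fin (n + 1) ⊕ Fin n where
  toFun
    | upper i => .inl i
    | lower i => .inr (.inl i)
    | step j => .inr (.inr j)
  invFun
    | .inl i => upper i
    | .inr (.inl i) => lower i
    | .inr (.inr j) => step j
  left_inv a := by cases a <;> rfl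
  right_inv a := by rcases a with i | i | j <;> rfl

instance : Finite (PellInequality n) := Finite.of_equiv _ equivSum.symm

theorem card_eq (n : ℕ) : Nat.card (PellInequality n) = 3 * n + 2 := by
  simp only [Nat.card_congr equivSum, Nat.card_sum, Nat.card_fin]
  omega

/-- The outer facet normal `e_i`, `-e_i` or `e_{j+1} - e_j`. -/
def normal : PellInequality n → StrongDual ℝ (Fin (n + 1) → ℝ)
  | upper i => .proj i
  | lower i => -.proj i
  | step j => .proj (φ := fun _ => ℝ) j.succ - .proj (φ := fun _ => ℝ) j.castSucc

@[simp] theorem normal_upper (i : Fin (n + 1)) (x : Fin (n + 1) → ℝ) :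
    normal (upper i) x = x i := rfl

@[simp] theorem normal_lower (i : Fin (n + 1)) (x : Fin (n + 1) → ℝ) :
    normal (lower i) x = -x i := rfl

@[simp] theorem normal_step (j : Fin n) (x : Fin (n + 1) → ℝ) :
    normal (step j) x = x j.succ - x j.castSucc := rfl

/-- The right-hand side of a facet inequality. -/
def bound : PellInequality n → ℕ
  | upper i => 1 + hasNext i + hasPrev i
  | lower _ => 0
  | step j => 1 + hasNext j.succ

end PellInequality

end Inequalities

section Words

open PellInequality (normal bound)

variable {n : ℕ}

/-- The index of the facet inequality that, in the cone of the word `w`, belongs to the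
coordinate `i`. The values `.upper i` of `Fin.cons` and `Fin.snoc` are junk: a word neither starts
with `stepIn` nor ends with `stepOut`. -/
def pellCone (w : Fin (n + 1) → PellLetter) (i : Fin (n + 1)) : PellInequality n :=
  match w i with
  | lower => .lower i
  | upper => .upper i
  | stepIn => Fin.cons (α := fun _ => PellInequality n) (.upper i) .step i
  | stepOut => Fin.snoc (α := fun _ => PellInequality n) .step (.upper i) i

/-- The coordinates of the vertex that belongs to the word `w`. -/
def pellVertex (w : Fin (n + 1) → PellLetter) (i : Fin (n + 1)) : ℕ :=
  match w i with
  | lower => 0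
  | upper => 1 + hasNext i + hasPrev i
  | stepIn => 1 + hasNext i
  | stepOut => 1

/-- The point at which the normals of the cone of `w` take the values `t`, that is, the inverse
of the linear map `x ↦ (normal (pellCone w i) x)_i`. -/
def pellSolve (w : Fin (n + 1) → PellLetter) (t : Fin (n + 1) → ℝ) (i : Fin (n + 1)) : ℝ :=
  match w i with
  | lower => -t i
  | upper => t i
  | stepIn => Fin.cons (α := fun _ => ℝ) 0 (fun j => t j.succ - t j.castSucc) i
  | stepOut => Fin.snoc (α := fun _ => ℝ) (fun j => t j.succ - t j.castSucc) 0 i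

section Letters

variable {w : Fin (n + 1) → PellLetter} {i : Fin (n + 1)} {j : Fin n} (t : Fin (n + 1) → ℝ)

theorem pellCone_of_lower (hi : w i = lower) : pellCone w i = .lower i := by simp [pellCone, hi]

theorem pellCone_of_upper (hi : w i = upper) : pellCone w i = .upper i := by simp [pellCone, hi]

theorem pellCone_of_stepIn (hj : w j.succ = stepIn) : pellCone w j.succ = .step j := by
  simp [pellCone, hj]

theorem pellCone_of_stepOut (hj : w j.castSucc = stepOut) : pellCone w j.castSucc = .step j := by
  simp [pellCone, hj]

theorem pellVertex_of_lower (hi : w i = lower) : pellVertex w i = 0 := by simp [pellVertex, hi]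

theorem pellVertex_of_upper (hi : w i = upper) : pellVertex w i = 1 + hasNext i + hasPrev i := by
  simp [pellVertex, hi]

theorem pellVertex_of_stepIn (hi : w i = stepIn) : pellVertex w i = 1 + hasNext i := by
  simp [pellVertex, hi]

theorem pellVertex_of_stepOut (hi : w i = stepOut) : pellVertex w i = 1 := by
  simp [pellVertex, hi]

theorem pellSolve_of_lower (hi : w i = lower) : pellSolve w t i = -t i := by simp [pellSolve, hi]

theorem pellSolve_of_upper (hi : w i = upper) : pellSolve w t i = t i := by simp [pellSolve, hi]

theorem pellSolve_of_stepIn (hj : w j.succ = stepIn) :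
    pellSolve w t j.succ = t j.succ - t j.castSucc := by
  simp [pellSolve, hj]

theorem pellSolve_of_stepOut (hj : w j.castSucc = stepOut) :
    pellSolve w t j.castSucc = t j.succ - t j.castSucc := by
  simp [pellSolve, hj]

end Letters

namespace IsPellWord

variable {w : Fin (n + 1) → PellLetter} (hw : IsPellWord w)
include hw

@[elab_as_elim]
theorem coordinateCases {motive : Fin (n + 1) → Prop}
    (lower : ∀ i, w i = .lower → motive i)
    (upper : ∀ i, w i = .upper → motive i)
    (stepIn : ∀ j : Fin n, w j.castSucc = .lower → w j.succ = .stepIn → motive j.succ)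
    (stepOut : ∀ j : Fin n, w j.castSucc = .stepOut → w j.succ = .upper → motive j.castSucc)
    (i : Fin (n + 1)) : motive i := by
  cases hi : w i with
  | lower => exact lower i hi
  | upper => exact upper i hi
  | stepIn =>
    obtain ⟨j, rfl, hj⟩ := hw.exists_succ hi
    exact stepIn j hj hi
  | stepOut =>
    obtain ⟨j, rfl, hj⟩ := hw.exists_castSucc hi
    exact stepOut j hi hj

theorem normal_pellCone_pellSolve (t : Fin (n + 1) → ℝ) (i : Fin (n + 1)) :
    normal (pellCone w i) (pellSolve w t) = t i := by
  induction i using hw.coordinateCases with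
  | lower i hi => simp [pellCone_of_lower hi, pellSolve_of_lower t hi]
  | upper i hi => simp [pellCone_of_upper hi, pellSolve_of_upper t hi]
  | stepIn j hj hi =>
    simp [pellCone_of_stepIn hi, pellSolve_of_stepIn t hi, pellSolve_of_lower t hj]
  | stepOut j hi hj =>
    simp [pellCone_of_stepOut hi, pellSolve_of_stepOut t hi, pellSolve_of_upper t hj]

theorem pellSolve_normal_pellCone (x : Fin (n + 1) → ℝ) :
    pellSolve w (fun i => normal (pellCone w i) x) = x := by
  ext i
  induction i using hw.coordinateCases with
  | lower i hi => simp [pellSolve_of_lower _ hi, pellCone_of_lower hi]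
  | upper i hi => simp [pellSolve_of_upper _ hi, pellCone_of_upper hi]
  | stepIn j hj hi =>
    simp [pellSolve_of_stepIn _ hi, pellCone_of_stepIn hi, pellCone_of_lower hj]
  | stepOut j hi hj =>
    simp [pellSolve_of_stepOut _ hi, pellCone_of_stepOut hi, pellCone_of_upper hj]

theorem normal_pellCone_pellVertex (i : Fin (n + 1)) :
    normal (pellCone w i) (fun i => (pellVertex w i : ℝ)) = bound (pellCone w i) := by
  induction i using hw.coordinateCases with
  | lower i hi => simp [pellCone_of_lower hi, pellVertex_of_lower hi, bound]
  | upper i hi => simp [pellCone_of_upper hi, pellVertex_of_upper hi, bound]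
  | stepIn j hj hi =>
    simp [pellCone_of_stepIn hi, pellVertex_of_stepIn hi, pellVertex_of_lower hj, bound]
  | stepOut j hi hj =>
    simp [pellCone_of_stepOut hi, pellVertex_of_stepOut hi, pellVertex_of_upper hj, bound]

/-- The basis dual to the normals of the cone of a word. -/
noncomputable def edge : Module.Basis (Fin (n + 1)) ℝ (Fin (n + 1) → ℝ) :=
  .ofEquivFun
    { toFun x i := normal (pellCone w i) x
      map_add' x y := by ext; simp
      map_smul' r x := by ext; simp
      invFun := pellSolve w
      left_inv := hw.pellSolve_normal_pellCone
      right_inv t := funext (hw.normal_pellCone_pellSolve t) }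

theorem edge_apply (j : Fin (n + 1)) : hw.edge j = pellSolve w (Pi.single j 1) := by
  rw [edge, Module.Basis.coe_ofEquivFun]
  rfl

theorem edge_of_stepIn {j : Fin (n + 1)} (hj : w j = stepIn) : hw.edge j = Pi.single j 1 := by
  rw [edge_apply]
  ext i
  induction i using hw.coordinateCases <;>
    grind [pellSolve_of_lower, pellSolve_of_upper, pellSolve_of_stepIn, pellSolve_of_stepOut]

theorem edge_of_stepOut {j : Fin (n + 1)} (hj : w j = stepOut) : hw.edge j = -Pi.single j 1 := by
  rw [edge_apply]
  ext i
  induction i using hw.coordinateCases <;>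
    grind [Pi.neg_apply, pellSolve_of_lower, pellSolve_of_upper, pellSolve_of_stepIn,
      pellSolve_of_stepOut]

theorem edge_of_lower {j : Fin (n + 1)} (hj : w j = lower)
    (hnext : ∀ k : Fin n, j = k.castSucc → w k.succ ≠ stepIn) : hw.edge j = -Pi.single j 1 := by
  rw [edge_apply]
  ext i
  induction i using hw.coordinateCases <;>
    grind [Pi.neg_apply, pellSolve_of_lower, pellSolve_of_upper, pellSolve_of_stepIn,
      pellSolve_of_stepOut]

theorem edge_castSucc_of_stepIn {k : Fin n} (hk : w k.succ = stepIn) :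
    hw.edge k.castSucc = -(Pi.single k.castSucc 1 + Pi.single k.succ 1) := by
  rw [edge_apply]
  ext i
  have := (hw.follows k).1 hk
  induction i using hw.coordinateCases <;>
    grind [Pi.add_apply, Pi.neg_apply, pellSolve_of_lower, pellSolve_of_upper, pellSolve_of_stepIn,
      pellSolve_of_stepOut]

theorem edge_of_upper {j : Fin (n + 1)} (hj : w j = upper)
    (hprev : ∀ k : Fin n, j = k.succ → w k.castSucc ≠ stepOut) : hw.edge j = Pi.single j 1 := by
  rw [edge_apply]
  ext i
  induction i using hw.coordinateCases <;>
    grind [pellSolve_of_lower, pellSolve_of_upper, pellSolve_of_stepIn, pellSolve_of_stepOut]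

theorem edge_succ_of_stepOut {k : Fin n} (hk : w k.castSucc = stepOut) :
    hw.edge k.succ = Pi.single k.castSucc 1 + Pi.single k.succ 1 := by
  rw [edge_apply]
  ext i
  have := (hw.follows k).2.1 hk
  induction i using hw.coordinateCases <;>
    grind [Pi.add_apply, pellSolve_of_lower, pellSolve_of_upper, pellSolve_of_stepIn,
      pellSolve_of_stepOut]

theorem hasPrev_eq_one {i : Fin (n + 1)} (hi : w i = stepIn) : hasPrev i = 1 := by
  obtain ⟨j, rfl, -⟩ := hw.exists_succ hi
  exact hasPrev_succ j

theorem hasNext_eq_one {i : Fin (n + 1)} (hi : w i = stepOut) : hasNext i = 1 := by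
  obtain ⟨j, rfl, -⟩ := hw.exists_castSucc hi
  exact hasNext_castSucc j

theorem normal_pellVertex_lt {a : PellInequality n} (ha : a ∉ Set.range (pellCone w)) :
    normal a (fun i => (pellVertex w i : ℝ)) < bound a := by
  have ha (i) : pellCone w i ≠ a := fun h => ha ⟨i, h⟩
  cases a with
  | upper i =>
    have hlt : pellVertex w i < bound (.upper i) := by
      induction i using hw.coordinateCases with
      | lower i hi => simp [pellVertex_of_lower hi, bound, add_assoc]
      | upper i hi => exact absurd (pellCone_of_upper hi) (ha i)
      | stepIn j _ hi => simp [pellVertex_of_stepIn hi, bound]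
      | stepOut j hi _ => simp [pellVertex_of_stepOut hi, bound, Nat.lt_add_right]
    simpa using (Nat.cast_lt (α := ℝ)).2 hlt
  | lower i =>
    have hpos : 0 < pellVertex w i := by
      cases hi : w i with
      | lower => exact absurd (pellCone_of_lower hi) (ha i)
      | _ => simp [hi, pellVertex, add_assoc]
    simpa [bound] using hpos
  | step j =>
    have hlt : pellVertex w j.succ < bound (.step j) + pellVertex w j.castSucc := by
      have hsucc : w j.succ ≠ stepIn := fun h => ha _ (pellCone_of_stepIn h)
      have hcast : w j.castSucc ≠ stepOut := fun h => ha _ (pellCone_of_stepOut h)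
      have hnext : w j.succ = stepOut → hasNext j.succ = 1 := hw.hasNext_eq_one
      have hfollows := hw.follows j
      cases hs : w j.succ <;> cases hc : w j.castSucc <;>
        simp_all [pellVertex, bound, Follows] <;> omega
    rw [← Nat.cast_lt (α := ℝ), Nat.cast_add] at hlt
    simpa [sub_lt_iff_lt_add] using hlt

theorem eq_of_pellVertex_eq {w' : Fin (n + 1) → PellLetter} (hw' : IsPellWord w')
    (h : pellVertex w = pellVertex w') : w = w' := by
  ext1 i
  have hi := congrFun h i
  grind [pellVertex, hw.hasPrev_eq_one, hw'.hasPrev_eq_one, hw.hasNext_eq_one, hw'.hasNext_eq_one]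

end IsPellWord

section Complete

/-- The word of the cone that contains the functional with coefficients `c`. -/
noncomputable def pellWordOf (c : Fin (n + 1) → ℝ) (i : Fin (n + 1)) : PellLetter :=
  open Classical in
  if 0 < c i then
    if ∃ j : Fin n, i = j.succ ∧ c j.castSucc ≤ 0 ∧ c j.castSucc + c j.succ ≤ 0 then stepIn
    else upper
  else
    if ∃ j : Fin n, i = j.castSucc ∧ 0 < c j.succ ∧ 0 < c j.castSucc + c j.succ then stepOut
    else lower

variable (c : Fin (n + 1) → ℝ) {i : Fin (n + 1)}

theorem pellWordOf_eq_stepIn_iff : pellWordOf c i = stepIn ↔ 0 < c i ∧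
    ∃ j : Fin n, i = j.succ ∧ c j.castSucc ≤ 0 ∧ c j.castSucc + c j.succ ≤ 0 := by
  unfold pellWordOf
  split_ifs <;> simp_all

theorem pellWordOf_eq_stepOut_iff : pellWordOf c i = stepOut ↔ c i ≤ 0 ∧
    ∃ j : Fin n, i = j.castSucc ∧ 0 < c j.succ ∧ 0 < c j.castSucc + c j.succ := by
  unfold pellWordOf
  split_ifs <;> simp_all

theorem pellWordOf_eq_upper_iff : pellWordOf c i = upper ↔ 0 < c i ∧
    ∀ j : Fin n, i = j.succ → c j.castSucc ≤ 0 → 0 < c j.castSucc + c j.succ := by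
  unfold pellWordOf
  split_ifs <;> simp_all

theorem pellWordOf_eq_lower_iff : pellWordOf c i = lower ↔ c i ≤ 0 ∧
    ∀ j : Fin n, i = j.castSucc → 0 < c j.succ → c j.castSucc + c j.succ ≤ 0 := by
  unfold pellWordOf
  split_ifs <;> simp_all

theorem pellWordOf_succ_eq_stepIn_iff {j : Fin n} : pellWordOf c j.succ = stepIn ↔
    c j.castSucc ≤ 0 ∧ 0 < c j.succ ∧ c j.castSucc + c j.succ ≤ 0 := by
  simp only [pellWordOf_eq_stepIn_iff, Fin.succ_inj, exists_eq_left']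
  exact and_left_comm

theorem pellWordOf_castSucc_eq_stepOut_iff {j : Fin n} : pellWordOf c j.castSucc = stepOut ↔
    c j.castSucc ≤ 0 ∧ 0 < c j.succ ∧ 0 < c j.castSucc + c j.succ := by
  simp only [pellWordOf_eq_stepOut_iff, Fin.castSucc_inj, exists_eq_left']

theorem isPellWord_pellWordOf : IsPellWord (pellWordOf c) where
  zero h := by
    obtain ⟨-, j, hj, -⟩ := (pellWordOf_eq_stepIn_iff c).1 h
    exact (Fin.succ_ne_zero j) hj.symm
  last h := by
    obtain ⟨-, j, hj, -⟩ := (pellWordOf_eq_stepOut_iff c).1 h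
    exact (Fin.castSucc_ne_last j) hj.symm
  follows j := by
    simp only [Follows, pellWordOf_succ_eq_stepIn_iff, pellWordOf_castSucc_eq_stepOut_iff,
      pellWordOf_eq_upper_iff, pellWordOf_eq_lower_iff, Fin.succ_inj, Fin.castSucc_inj,
      forall_eq']
    grind

theorem apply_edge_pellWordOf_nonneg (u : StrongDual ℝ (Fin (n + 1) → ℝ)) (j : Fin (n + 1)) :
    0 ≤ u ((isPellWord_pellWordOf fun i => u (Pi.single i 1)).edge j) := by
  set c : Fin (n + 1) → ℝ := fun i => u (Pi.single i 1)
  have hw := isPellWord_pellWordOf c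
  cases hj : pellWordOf c j with
  | stepIn =>
    rw [hw.edge_of_stepIn hj]
    exact ((pellWordOf_eq_stepIn_iff c).1 hj).1.le
  | stepOut =>
    rw [hw.edge_of_stepOut hj, map_neg]
    exact neg_nonneg.2 ((pellWordOf_eq_stepOut_iff c).1 hj).1
  | lower =>
    by_cases hnext : ∃ k : Fin n, j = k.castSucc ∧ pellWordOf c k.succ = stepIn
    · obtain ⟨k, rfl, hk⟩ := hnext
      rw [hw.edge_castSucc_of_stepIn hk, map_neg, map_add]
      exact neg_nonneg.2 ((pellWordOf_succ_eq_stepIn_iff c).1 hk).2.2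
    · rw [hw.edge_of_lower hj fun k hjk hk => hnext ⟨k, hjk, hk⟩, map_neg]
      exact neg_nonneg.2 ((pellWordOf_eq_lower_iff c).1 hj).1
  | upper =>
    by_cases hprev : ∃ k : Fin n, j = k.succ ∧ pellWordOf c k.castSucc = stepOut
    · obtain ⟨k, rfl, hk⟩ := hprev
      rw [hw.edge_succ_of_stepOut hk, map_add]
      exact ((pellWordOf_castSucc_eq_stepOut_iff c).1 hk).2.2.le
    · rw [hw.edge_of_upper hj fun k hjk hk => hprev ⟨k, hjk, hk⟩]
      exact ((pellWordOf_eq_upper_iff c).1 hj).1.le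

end Complete

theorem exists_isPellWord_pellCone_eq (a : PellInequality n) :
    ∃ w, IsPellWord w ∧ ∃ i, pellCone w i = a := by
  cases a with
  | upper i =>
    exact ⟨fun _ => upper, ⟨by simp, by simp, by simp [Follows]⟩, i, pellCone_of_upper rfl⟩
  | lower i =>
    exact ⟨fun _ => lower, ⟨by simp, by simp, by simp [Follows]⟩, i, pellCone_of_lower rfl⟩
  | step j =>
    let w : Fin (n + 1) → PellLetter := fun i =>
      if i = j.succ then stepIn else if i < j.succ then lower else upper
    refine ⟨w, ⟨?_, ?_, fun k => ?_⟩, j.succ, pellCone_of_stepIn (if_pos rfl)⟩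
    · simp [w, (Fin.succ_ne_zero j).symm]
    · dsimp only [w]
      split_ifs <;> simp
    · simp only [w, Fin.ext_iff, Fin.lt_def, Fin.val_succ, Fin.val_castSucc, Follows]
      split_ifs <;> simp <;> omega

/-- The normal fan of the pellytope. -/
noncomputable def pellFan (n : ℕ) : SimplicialNormalFan (Fin (n + 1) → ℝ) (PellInequality n)
    {w : Fin (n + 1) → PellLetter // IsPellWord w} (Fin (n + 1)) where
  normal := normal
  bound a := bound a
  cone w := pellCone w
  edge w := w.2.edge
  vertex w i := pellVertex w.1 i
  normal_cone _ _ _ := rfl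
  complete u := ⟨⟨_, isPellWord_pellWordOf _⟩, apply_edge_pellWordOf_nonneg u⟩
  exists_cone a :=
    let ⟨w, hw, hi⟩ := exists_isPellWord_pellCone_eq a
    ⟨⟨w, hw⟩, hi⟩
  normal_cone_vertex w := w.2.normal_pellCone_pellVertex
  normal_vertex_lt w _ := w.2.normal_pellVertex_lt
  vertex_injective w w' h := Subtype.ext <| w.2.eq_of_pellVertex_eq w'.2 <|
    funext fun i => Nat.cast_injective (congrFun h i)

end Words

section Pellytope

open PellInequality (normal bound)

variable {n : ℕ}

theorem normal_le_bound_of_mem_support {m : Fin (n + 1) →₀ ℕ}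
    (hm : m ∈ (pellPolynomial (n + 1)).support) (a : PellInequality n) :
    normal a (fun i => (m i : ℝ)) ≤ bound a := by
  obtain ⟨p, q, r, hp, hr, hq, rfl⟩ := (mem_support_pellPolynomial m).1 hm
  have hsnoc (i) : Fin.snoc (α := fun _ => ℕ) q 0 i ≤ hasNext i := by
    induction i using Fin.lastCases <;> simp [hq]
  have hcons (i) : Fin.cons (α := fun _ => ℕ) 0 r i ≤ hasPrev i := by
    induction i using Fin.cases with
    | zero => simp
    | succ j => simpa using (hr j).trans (hq j)
  cases a with
  | upper i =>
    have hle : chosenExponent p q r i ≤ bound (.upper i) :=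
      add_le_add (add_le_add (hp i) (hsnoc i)) (hcons i)
    simpa using (Nat.cast_le (α := ℝ)).2 hle
  | lower i => simp [bound]
  | step j =>
    have hle : chosenExponent p q r j.succ ≤
        bound (.step j) + chosenExponent p q r j.castSucc := by
      have hp := hp j.succ
      have hq := hsnoc j.succ
      have hr := hr j
      simp only [chosenExponent, bound, Fin.snoc_castSucc, Fin.cons_succ]
      omega
    rw [← Nat.cast_le (α := ℝ), Nat.cast_add] at hle
    simpa [sub_le_iff_le_add] using hle

theorem IsPellWord.chosenExponent_eq_pellVertex {w : Fin (n + 1) → PellLetter}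
    (hw : IsPellWord w) :
    chosenExponent (fun i => if w i = upper ∨ w i = stepIn then 1 else 0)
      (fun j => if w j.castSucc = lower then 0 else 1)
      (fun j => if w j.succ = upper then 1 else 0) = pellVertex w := by
  ext i
  have hsnoc : Fin.snoc (α := fun _ => ℕ)
      (fun j : Fin n => if w j.castSucc = lower then 0 else 1) 0 i =
        if w i = lower then 0 else hasNext i := by
    induction i using Fin.lastCases <;> simp
  have hcons : Fin.cons (α := fun _ => ℕ) 0
      (fun j : Fin n => if w j.succ = upper then 1 else 0) i =
        if w i = upper then hasPrev i else 0 := by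
    induction i using Fin.cases <;> simp
  rw [chosenExponent, hsnoc, hcons]
  cases hi : w i with
  | stepOut => simp [pellVertex, hi, hw.hasNext_eq_one hi]
  | _ => simp [pellVertex, hi]

theorem IsPellWord.pellVertex_mem_support {w : Fin (n + 1) → PellLetter} (hw : IsPellWord w) :
    Finsupp.equivFunOnFinite.symm (pellVertex w) ∈ (pellPolynomial (n + 1)).support := by
  refine (mem_support_pellPolynomial _).2
    ⟨_, _, _, fun i => ?_, fun j => ?_, fun j => ?_,
      congrArg _ hw.chosenExponent_eq_pellVertex.symm⟩
  · split_ifs <;> simp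
  · have hfollows := hw.follows j
    split_ifs <;> simp_all [Follows]
  · split_ifs <;> simp

theorem pellytope_eq_polyhedron (n : ℕ) : pellytope (n + 1) = (pellFan n).polyhedron := by
  refine (pellFan n).convexHull_eq_polyhedron (fun w => ⟨_, w.2.pellVertex_mem_support, rfl⟩) ?_
  rintro _ ⟨m, hm, rfl⟩
  exact normal_le_bound_of_mem_support hm

end Pellytope

theorem mainTheorem4 (d : ℕ) (hd : 1 ≤ d) :
    IsSimplePolytope (pellytope d) ∧
      convexDim (pellytope d) = d ∧
      ((polytopeFacets (pellytope d)).Finite ∧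
        (polytopeFacets (pellytope d)).ncard = 3 * d - 1) ∧
      ((polytopeVertices (pellytope d)).Finite ∧
        (polytopeVertices (pellytope d)).ncard = pellNumber (d + 1)) := by
  obtain ⟨n, rfl⟩ := Nat.exists_eq_add_of_le' hd
  rw [pellytope_eq_polyhedron]
  refine ⟨(pellFan n).isSimplePolytope_polyhedron, ?_, ⟨?_, ?_⟩, ?_, ?_⟩
  · rw [SimplicialNormalFan.convexDim_polyhedron, Module.finrank_fin_fun]
  · rw [SimplicialNormalFan.polytopeFacets_polyhedron]
    exact Set.finite_range _
  · rw [SimplicialNormalFan.ncard_polytopeFacets, PellInequality.card_eq]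
    omega
  · rw [SimplicialNormalFan.polytopeVertices_polyhedron]
    exact Set.finite_range _
  · rw [SimplicialNormalFan.ncard_polytopeVertices, card_isPellWord]
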